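/- Let $X$ be an irreducible complex affine surface, that is, $X=\operatorname{Spec} A$ where $A=\mathcal O_X$ is a finitely generated $\mathbb C$-algebra which is an integral domain of Krull dimension $2$. Assume that $X$ is locally a complete intersection, and let $f:X\to\mathbb C$ be a dominant morphism, i.e. an element $f\in A$ such that the morphism $\operatorname{Spec}A\to\mathbb A^1$ it defines is dominant. Let $\operatorname{Sing}(f)$ be the set of (closed) points $x\in X$ such that either $X$ is singular at $x$ or $df$ vanishes at $x$ (i.e. $df\in\mathfrak m_x\Omega^1(X)$). Let $\Omega^0(X)=A$, let $\Omega^1(X)=\Omega^1_{A/\mathbb C}$ be the module of regular (Kähler) $1$-forms, and let $$H^1(f)=\frac{\Omega^1(X)}{d\Omega^0(X)+\Omega^0(X)\,df},$$ regarded as a $\mathbb C[f]$-module via $(P(f),\omega)\mapsto P(f)\omega$. Let $y\in\mathbb C$ be such that $f^{-1}(y)\cap\operatorname{Sing}(f)$ is finite. Then $H^1(f)$ has property $\mathcal P(y)$: for every integer $r\ge 0$ and every $\omega\in H^1(f)$, $$(f-y)^r\omega=0\ \text{ in } H^1(f)\quad\Longrightarrow\quad \omega\in (f-y)H^1(f).$$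 -/

import Mathlib

open scoped Polynomial

noncomputable section

namespace RelCohomology

/-- The affine `ℂ`-scheme `Spec A` is locally a complete intersection: for some closed embedding in
an affine space `𝔸ⁿ`, given by a surjection `π : ℂ[x₁, …, xₙ] → A`, the ideal `ker π` is generated
by a regular sequence in the local ring of `𝔸ⁿ` at each closed point of `Spec A`. -/
def IsLocallyCompleteIntersection (A : Type*) [CommRing A] [Algebra ℂ A] : Prop :=
  ∃ (n : ℕ) (π : MvPolynomial (Fin n) ℂ →ₐ[ℂ] A), Function.Surjective π ∧
    ∀ x : MaximalSpectrum A,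
      ∃ rs : List (Localization.AtPrime (x.asIdeal.comap π)),
        RingTheory.Sequence.IsRegular (Localization.AtPrime (x.asIdeal.comap π)) rs ∧
        Ideal.ofList rs = (RingHom.ker π).map
          (algebraMap (MvPolynomial (Fin n) ℂ) (Localization.AtPrime (x.asIdeal.comap π)))

variable {A : Type*} [CommRing A] [Algebra ℂ A]

/-- The morphism `Spec A → 𝔸¹ = Spec ℂ[t]` given by the regular function `f` (that is, by
`t ↦ f`) is dominant. -/
def IsDominantFunction (f : A) : Prop :=
  DenseRange (PrimeSpectrum.comap (Polynomial.aeval f : ℂ[X] →ₐ[ℂ] A).toRingHom)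

/-- The closed points of the fibre `f⁻¹(y)`. -/
def fibre (f : A) (y : ℂ) : Set (MaximalSpectrum A) :=
  {x | f - algebraMap ℂ A y ∈ x.asIdeal}

/-- The singular set of `f`: the closed points `x` of `X = Spec A` such that either `X` is not
smooth at `x`, or `df` vanishes at `x`, i.e. `df ∈ 𝔪ₓ Ω¹(X)`. -/
def singularSet (f : A) : Set (MaximalSpectrum A) :=
  {x | x.toPrimeSpectrum ∉ Algebra.smoothLocus ℂ A ∨
    KaehlerDifferential.D ℂ A f ∈ x.asIdeal • (⊤ : Submodule A (Ω[A⁄ℂ]))}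

/-- The subalgebra `ℂ[f]` of `A`. -/
abbrev polyIn (f : A) : Subalgebra ℂ A := Algebra.adjoin ℂ {f}

/-- `f` as an element of `ℂ[f]`. -/
def gen (f : A) : polyIn f := ⟨f, Algebra.self_mem_adjoin_singleton ℂ f⟩

/-- For `p ∈ ℂ[f]` the differential `dp` is a multiple of `df`. -/
theorem exists_D_eq_smul (f : A) {p : A} (hp : p ∈ polyIn f) :
    ∃ q : A, KaehlerDifferential.D ℂ A p = q • KaehlerDifferential.D ℂ A f := by
  induction hp using Algebra.adjoin_induction with
  | mem x hx => exact ⟨1, by rw [Set.mem_singleton_iff.1 hx, one_smul]⟩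
  | algebraMap r => exact ⟨0, by simp⟩
  | add x y _ _ hx hy =>
    obtain ⟨a, ha⟩ := hx
    obtain ⟨b, hb⟩ := hy
    exact ⟨a + b, by rw [map_add, ha, hb, add_smul]⟩
  | mul x y _ _ hx hy =>
    obtain ⟨a, ha⟩ := hx
    obtain ⟨b, hb⟩ := hy
    exact ⟨x * b + y * a, by rw [Derivation.leibniz, ha, hb, add_smul, mul_smul, mul_smul]⟩

/-- The `ℂ[f]`-submodule `dΩ⁰(X) + Ω⁰(X) df` of `Ω¹(X)`. -/
def relExact (f : A) : Submodule (polyIn f) (Ω[A⁄ℂ]) where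
  carrier := {ω | ∃ g a : A,
    ω = KaehlerDifferential.D ℂ A g + a • KaehlerDifferential.D ℂ A f}
  zero_mem' := ⟨0, 0, by simp⟩
  add_mem' := by
    rintro _ _ ⟨g, a, rfl⟩ ⟨h, b, rfl⟩
    exact ⟨g + h, a + b, by rw [map_add, add_smul]; abel⟩
  smul_mem' := by
    rintro ⟨p, hp⟩ _ ⟨g, a, rfl⟩
    obtain ⟨q, hq⟩ := exists_D_eq_smul f hp
    refine ⟨p * g, p * a - g * q, ?_⟩
    rw [Derivation.leibniz, hq, sub_smul, mul_smul, mul_smul, Subalgebra.smul_def, smul_add]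
    abel

/-- The first group of truncated relative cohomology
`H¹(f) = Ω¹(X) / (dΩ⁰(X) + Ω⁰(X) df)`, a module over `ℂ[f]`. -/
abbrev H1 (f : A) : Type _ := Ω[A⁄ℂ] ⧸ relExact f

/-- Property `P(y)` of a `ℂ[f]`-module `M`: if `(f - y)^r ω = 0` for some integer `r ≥ 0`, then
`ω ∈ (f - y) M`. -/
def PropertyP (f : A) (M : Type*) [AddCommGroup M] [Module (polyIn f) M] (y : ℂ) : Prop :=
  ∀ (r : ℕ) (ω : M), (gen f - algebraMap ℂ (polyIn f) y) ^ r • ω = 0 →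
    ∃ η : M, ω = (gen f - algebraMap ℂ (polyIn f) y) • η

end RelCohomology

end

/-!
Put `t = f - y` and suppose `t ^ r • ω = dg + a • df` with `r ≥ 1`. On the hypersurface `t = 0` the
differential of `g` vanishes, so `g` is constant on each of its components; since `A ⧸ (t)` is
reduced, `t` divides `p(g)` for some separable polynomial `p`. Newton's iteration changes `g` by a
multiple of `t` until `t ^ (r + 1)` divides `p(g)`, which forces `dg ∈ t ^ (r + 1) Ω¹ + A dt`.
Substituting this in the relation and cancelling one factor `t` lowers `r` by one, at the cost of
changing `ω` by an element of `t Ω¹`.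

Three facts make this possible: `A ⧸ (t)` is reduced, `t` divides `a` if `a dt ∈ t Ω¹`, and `t` is a
nonzerodivisor on `Ω¹`. Each holds near the points where `X` and `f` are smooth, hence away from
finitely many closed points of the fibre, and it extends across these because no closed point is an
associated prime of `Ω¹` or of `A ⧸ (t)`. For the latter, Cohen-Macaulayness provides a regular
pair `(a, b)` in the local ring `S` of a closed point. For the former, counting ranks shows that the
conormal sequence `0 → Sᶜ → Sⁿ → Ω¹ → 0` of a complete intersection is exact on the left, so an
element of `Ω¹` killed by both `a` and `b` is zero.
-/

namespace RelCohomology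

open RingTheory.Sequence CategoryTheory Abelian IsLocalRing KaehlerDifferential
open scoped TensorProduct

/-! ### Regular sequences -/

section RegularPair

variable {R M : Type*} [CommRing R] [AddCommGroup M] [Module R M] {a b : R}

theorem isWeaklyRegular_pair_iff :
    IsWeaklyRegular M [a, b] ↔
      IsSMulRegular M a ∧ ∀ x y : M, b • x = a • y → ∃ z, x = a • z := by
  rw [isWeaklyRegular_cons_iff, isWeaklyRegular_singleton_iff]
  refine and_congr_right fun _ ↦ ?_
  rw [isSMulRegular_quotient_iff_mem_of_smul_mem]
  simp only [Submodule.mem_smul_pointwise_iff_exists, Submodule.mem_top, true_and,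
    forall_exists_index]
  exact forall_congr' fun x ↦ forall_congr' fun y ↦ by simp only [eq_comm]

theorem isWeaklyRegular_pair_pi {ι : Type*} (h : IsWeaklyRegular M [a, b]) :
    IsWeaklyRegular (ι → M) [a, b] := by
  rw [isWeaklyRegular_pair_iff] at h ⊢
  refine ⟨.pi fun _ ↦ h.1, fun x y hxy ↦ ?_⟩
  choose z hz using fun i ↦ h.2 (x i) (y i) (congrFun hxy i)
  exact ⟨z, funext hz⟩

theorem mem_range_of_smul_mem_range {N : Type*} [AddCommGroup N] [Module R N] {T : M →ₗ[R] N}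
    (hT : Function.Injective T) (hM : IsWeaklyRegular M [a, b]) (hN : IsSMulRegular N a)
    {x : N} (hax : a • x ∈ T.range) (hbx : b • x ∈ T.range) : x ∈ T.range := by
  obtain ⟨c, hc⟩ := hax
  obtain ⟨d, hd⟩ := hbx
  have hcd : b • c = a • d := hT <| by rw [map_smul, map_smul, hc, hd, smul_comm]
  obtain ⟨e, rfl⟩ := (isWeaklyRegular_pair_iff.1 hM).2 c d hcd
  exact ⟨e, hN (by simpa only [map_smul] using hc)⟩

end RegularPair

section LocalRing

variable {R M : Type*} [CommRing R] [IsLocalRing R] [AddCommGroup M] [Module R M]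

theorem mem_maximalIdeal_of_isRegular {rs : List R} (h : IsRegular M rs) {r : R} (hr : r ∈ rs) :
    r ∈ maximalIdeal R := by
  by_contra hunit
  refine h.top_ne_smul ?_
  rw [Ideal.eq_top_of_isUnit_mem (Ideal.ofList rs) (Ideal.subset_span hr)
    (notMem_maximalIdeal.1 hunit), Submodule.top_smul]

theorem support_residueField :
    Module.support R (ResidueField R) = PrimeSpectrum.zeroLocus (maximalIdeal R) := by
  rw [Module.support_eq_zeroLocus]
  exact congrArg (fun I : Ideal R ↦ PrimeSpectrum.zeroLocus (I : Set R)) Ideal.annihilator_quotient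

theorem maximalIdeal_smul_top_lt_top [Module.Finite R M] [Nontrivial M] :
    maximalIdeal R • (⊤ : Submodule R M) < ⊤ :=
  (Submodule.top_ne_ideal_smul_of_le_jacobson_annihilator
    (maximalIdeal_le_jacobson _)).symm.lt_top

end LocalRing

section Prolongation

universe u

variable {R M : Type u} [CommRing R] [IsNoetherianRing R] [IsLocalRing R] [AddCommGroup M]
  [Module R M] [Module.Finite R M]

theorem exists_isRegular_append_of_subsingleton_ext {rs : List R} {j : ℕ} (h : IsRegular M rs)
    (hext : ∀ i < rs.length + j,
      Subsingleton (Ext (ModuleCat.of R (ResidueField R)) (ModuleCat.of R M) i)) :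
    ∃ rs' : List R, rs'.length = j ∧ IsRegular M (rs ++ rs') := by
  induction rs generalizing M with
  | nil =>
    have := h.nontrivial
    obtain ⟨rs', hlen, -, hreg⟩ := ModuleCat.exists_isRegular_of_exists_subsingleton_ext
      (maximalIdeal R) j (.of R M) maximalIdeal_smul_top_lt_top (.of R (ResidueField R))
      support_residueField (by simpa using hext)
    exact ⟨rs', hlen, hreg⟩
  | cons x rs ih =>
    rw [isRegular_cons_iff] at h
    obtain ⟨rs', hlen, hreg⟩ := ih h.2 fun i hi ↦ by
      have hzero (l : ℕ) (hl : l ≤ i + 1) := AddCommGrpCat.isZero_of_iff_subsingleton.2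
        (hext l (by rw [List.length_cons]; omega))
      exact AddCommGrpCat.subsingleton_of_isZero <| ShortComplex.Exact.isZero_of_both_zeros
        (Ext.covariant_sequence_exact₃' _
          (IsSMulRegular.smulShortComplex_shortExact (M := .of R M) h.1) i (i + 1) rfl)
        ((hzero i (by omega)).eq_zero_of_src _) ((hzero (i + 1) le_rfl).eq_zero_of_tgt _)
    exact ⟨rs', hlen, .cons h.1 hreg⟩

theorem exists_isRegular_append {xs rs : List R} {j : ℕ} (hxs : IsRegular M xs)
    (hrs : IsRegular M rs) (hj : rs.length + j ≤ xs.length) :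
    ∃ rs' : List R, rs'.length = j ∧ IsRegular M (rs ++ rs') := by
  have := hxs.nontrivial
  exact exists_isRegular_append_of_subsingleton_ext hrs fun i hi ↦
    ModuleCat.subsingleton_ext_of_exists_isRegular (maximalIdeal R) _ support_residueField.subset
      (.of R M) maximalIdeal_smul_top_lt_top xs (fun _ ↦ mem_maximalIdeal_of_isRegular hxs) hxs i
      (hi.trans_le hj)

theorem exists_isRegular_of_ker_eq_ofList {S : Type*} [CommRing S] [Algebra R S]
    (hsurj : Function.Surjective (algebraMap R S)) {xs rs : List R} {j : ℕ} (hxs : IsRegular R xs)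
    (hrs : IsRegular R rs) (hker : RingHom.ker (algebraMap R S) = Ideal.ofList rs)
    (hj : rs.length + j ≤ xs.length) : ∃ ss : List S, ss.length = j ∧ IsRegular S ss := by
  obtain ⟨rs', hlen, hreg⟩ := exists_isRegular_append hxs hrs hj
  refine ⟨rs'.map (algebraMap R S), by rw [List.length_map, hlen], ?_, ?_⟩
  · rw [isWeaklyRegular_map_algebraMap_iff]
    let e : (R ⧸ (Ideal.ofList rs • ⊤ : Ideal R)) ≃ₗ[R] S :=
      (Submodule.quotEquivOfEq _ _ (by rw [smul_eq_mul, Ideal.mul_top, ← hker]; rfl)).trans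
        ((Algebra.linearMap R S).quotKerEquivOfSurjective hsurj)
    exact (e.isWeaklyRegular_congr rs').1 ((isWeaklyRegular_append_iff R rs rs').1 hreg.1).2
  · intro htop
    refine hreg.2 ?_
    rw [smul_eq_mul, Ideal.mul_top, ← Ideal.map_ofList] at htop
    rw [smul_eq_mul, Ideal.mul_top, Ideal.ofList_append, ← hker, sup_comm, RingHom.ker,
      ← Ideal.comap_map_of_surjective _ hsurj, ← htop, Ideal.comap_top]

end Prolongation

/-! ### Polynomial rings -/

section PartialEval

variable {R : Type*} [CommRing R] {n : ℕ} (a : Fin n → R) (j : ℕ)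

/-- The endomorphism of `R[x₀, …, xₙ₋₁]` which substitutes `a i` for `xᵢ` when `i < j` and fixes the
other variables; it realizes the quotient by the first `j` of the polynomials `xᵢ - a i`. -/
noncomputable def partialEval : MvPolynomial (Fin n) R →ₐ[R] MvPolynomial (Fin n) R :=
  MvPolynomial.aeval fun i ↦ if (i : ℕ) < j then MvPolynomial.C (a i) else MvPolynomial.X i

theorem partialEval_X_of_lt {i : Fin n} (hi : (i : ℕ) < j) :
    partialEval a j (MvPolynomial.X i) = MvPolynomial.C (a i) := by
  simp [partialEval, hi]

theorem partialEval_X_of_le {i : Fin n} (hi : j ≤ i) :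
    partialEval a j (MvPolynomial.X i) = MvPolynomial.X i := by
  simp [partialEval, hi]

theorem partialEval_C (r : R) : partialEval a j (MvPolynomial.C r) = MvPolynomial.C r :=
  (partialEval a j).commutes r

theorem ker_partialEval : RingHom.ker (partialEval a j) =
    Ideal.ofList ((List.ofFn fun i ↦ MvPolynomial.X i - MvPolynomial.C (a i)).take j) := by
  set I := Ideal.ofList ((List.ofFn fun i ↦ MvPolynomial.X i - MvPolynomial.C (a i)).take j)
  refine le_antisymm (fun p hp ↦ ?_) (Ideal.span_le.2 fun p hp ↦ ?_)
  · have hcomp : (Ideal.Quotient.mkₐ R I).comp (partialEval a j) = Ideal.Quotient.mkₐ R I := by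
      refine MvPolynomial.algHom_ext fun i ↦ ?_
      rw [AlgHom.comp_apply]
      rcases lt_or_ge (i : ℕ) j with hi | hi
      · rw [partialEval_X_of_lt a j hi]
        refine (Ideal.Quotient.eq.2 (Ideal.subset_span ?_)).symm
        exact List.mem_iff_getElem.2 ⟨i, by simp [hi], by simp⟩
      · rw [partialEval_X_of_le a j hi]
    have := DFunLike.congr_fun hcomp p
    rw [AlgHom.comp_apply, RingHom.mem_ker.1 hp, map_zero] at this
    exact Ideal.Quotient.eq_zero_iff_mem.1 this.symm
  · obtain ⟨i, hi, rfl⟩ := List.mem_iff_getElem.1 (show p ∈ List.take j _ from hp)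
    have hi' : i < j ∧ i < n := by simpa using hi
    simp [partialEval, RingHom.mem_ker, hi'.1]

theorem isWeaklyRegular_X_sub_C [IsDomain R] :
    IsWeaklyRegular (MvPolynomial (Fin n) R)
      (List.ofFn fun i ↦ MvPolynomial.X i - MvPolynomial.C (a i)) := by
  rw [isWeaklyRegular_iff]
  intro j hj
  have hjn : j < n := by simpa using hj
  rw [smul_eq_mul, Ideal.mul_top, ← ker_partialEval, isSMulRegular_quotient_iff_mem_of_smul_mem]
  intro p hp
  rw [List.getElem_ofFn, smul_eq_mul, RingHom.mem_ker, map_mul, map_sub,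
    partialEval_X_of_le a j le_rfl, partialEval_C] at hp
  refine (mul_eq_zero.1 hp).resolve_left fun hX ↦ ?_
  have := congrArg (MvPolynomial.eval fun _ ↦ a ⟨j, hjn⟩ + 1) hX
  simp at this

end PartialEval

section ClosedPoint

theorem ringKrullDim_mvPolynomial_fin (k : Type*) [Field k] (n : ℕ) :
    ringKrullDim (MvPolynomial (Fin n) k) = n := by
  simp [MvPolynomial.ringKrullDim_of_isNoetherianRing]

variable {k : Type*} [Field k] [IsAlgClosed k] {n : ℕ} (q : Ideal (MvPolynomial (Fin n) k))
  [hq : q.IsMaximal]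

theorem exists_isRegular_localization :
    ∃ xs : List (Localization.AtPrime q), xs.length = n ∧
      IsRegular (Localization.AtPrime q) xs := by
  obtain ⟨a, rfl⟩ := MvPolynomial.isMaximal_iff_eq_vanishingIdeal_singleton.1 hq
  refine ⟨_, ?_, (isWeaklyRegular_X_sub_C a).isRegular_of_isLocalization_of_mem _
    (MvPolynomial.vanishingIdeal k {a}) fun r hr ↦ ?_⟩
  · rw [List.length_map, List.length_ofFn]
  · obtain ⟨i, rfl⟩ := (List.mem_ofFn' _ _).1 hr
    simp

theorem height_mvPolynomial_eq : q.height = n := by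
  have hle := Ideal.height_le_ringKrullDim_of_ne_top hq.ne_top
  obtain ⟨xs, hlen, hreg⟩ := exists_isRegular_localization q
  have heq := ringKrullDim_add_length_eq_ringKrullDim_of_isRegular xs hreg
  have : Nontrivial (Localization.AtPrime q ⧸ Ideal.ofList xs) :=
    Ideal.Quotient.nontrivial_iff.2 fun h ↦ hreg.2 (by simp [h])
  have hge : (n : WithBot ℕ∞) ≤ q.height := by
    rw [← IsLocalization.AtPrime.ringKrullDim_eq_height q (Localization.AtPrime q), ← heq, hlen]
    exact le_add_of_nonneg_left ringKrullDim_nonneg_of_nontrivial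
  exact_mod_cast le_antisymm (hle.trans_eq (ringKrullDim_mvPolynomial_fin k n)) hge

end ClosedPoint

section Dimension

theorem ringKrullDim_le_of_isIntegral (R A : Type*) [CommRing R] [CommRing A] [Algebra R A]
    [Algebra.IsIntegral R A] : ringKrullDim A ≤ ringKrullDim R :=
  Order.krullDim_le_of_strictMono (PrimeSpectrum.comap (algebraMap R A)) fun _ _ h ↦
    Ideal.IsIntegral.comap_lt_comap (R := R) h

variable {k A : Type*} [Field k] [IsAlgClosed k] [CommRing A] [IsDomain A]

theorem natCast_le_height_of_isIntegral {d : ℕ} [IsNoetherianRing A]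
    [Algebra (MvPolynomial (Fin d) k) A] [Algebra.IsIntegral (MvPolynomial (Fin d) k) A]
    [FaithfulSMul (MvPolynomial (Fin d) k) A] (m : Ideal A) [m.IsMaximal] : d ≤ m.height := by
  have : (m.under (MvPolynomial (Fin d) k)).IsMaximal :=
    Ideal.isMaximal_comap_of_isIntegral_of_isMaximal m
  rw [Ideal.height_eq_height_add_of_liesOver_of_hasGoingDown
    (m.under (MvPolynomial (Fin d) k)) m, height_mvPolynomial_eq]
  exact le_self_add

variable (k A) [Algebra k A] [Algebra.FiniteType k A]

theorem exists_normalization_forall_height_eq : ∃ (d : ℕ) (φ : MvPolynomial (Fin d) k →ₐ[k] A),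
    Function.Injective φ ∧ φ.toRingHom.IsIntegral ∧ ringKrullDim A = d ∧
      ∀ m : Ideal A, m.IsMaximal → m.height = d := by
  obtain ⟨d, φ, hinj, hint⟩ := exists_integral_inj_algHom_of_fg k A
  algebraize [φ.toRingHom]
  have : Algebra.IsIntegral (MvPolynomial (Fin d) k) A := ⟨hint⟩
  have : FaithfulSMul (MvPolynomial (Fin d) k) A :=
    (faithfulSMul_iff_algebraMap_injective _ _).2 hinj
  have : IsNoetherianRing A := Algebra.FiniteType.isNoetherianRing k A
  have hle : ringKrullDim A ≤ d :=
    (ringKrullDim_le_of_isIntegral (MvPolynomial (Fin d) k) A).trans_eq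
      (ringKrullDim_mvPolynomial_fin k d)
  have hheight (m : Ideal A) (hm : m.IsMaximal) : m.height = d := by
    refine le_antisymm ?_ (natCast_le_height_of_isIntegral (k := k) m)
    exact_mod_cast (Ideal.height_le_ringKrullDim_of_ne_top hm.ne_top).trans hle
  obtain ⟨m, hm⟩ := Ideal.exists_maximal A
  refine ⟨d, φ, hinj, hint, hle.antisymm ?_, hheight⟩
  have := Ideal.height_le_ringKrullDim_of_ne_top hm.ne_top
  rwa [hheight m hm] at this

end Dimension

theorem ringKrullDim_localization_eq (k : Type*) [Field k] [IsAlgClosed k] {A : Type*} [CommRing A]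
    [IsDomain A] [Algebra k A] [Algebra.FiniteType k A] (m : Ideal A) [hm : m.IsMaximal] :
    ringKrullDim (Localization.AtPrime m) = ringKrullDim A := by
  obtain ⟨d, -, -, -, hdim, hheight⟩ := exists_normalization_forall_height_eq k A
  rw [IsLocalization.AtPrime.ringKrullDim_eq_height m, hheight m hm, hdim]
  rfl

/-! ### Differentials of complete intersections -/

section LocalizationMap

variable {k R S : Type*} [CommRing k] [CommRing R] [CommRing S] [Algebra k R] [Algebra k S]
  {π : R →ₐ[k] S}

theorem localAlgHom_comap_surjective (hπ : Function.Surjective π) (p : Ideal S) [p.IsPrime] :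
    Function.Surjective (Localization.localAlgHom (p.comap π) p π rfl) :=
  RingHom.surjectiveOnStalks_of_surjective (f := π.toRingHom) hπ p ‹_›

theorem ker_localAlgHom_comap (hπ : Function.Surjective π) (p : Ideal S) [p.IsPrime] :
    RingHom.ker (Localization.localAlgHom (p.comap π) p π rfl) =
      (RingHom.ker π).map (algebraMap R (Localization.AtPrime (p.comap π))) :=
  IsLocalization.ker_map (S := Localization.AtPrime (p.comap π.toRingHom)) _ π.toRingHom
    (p.map_primeCompl_comap_of_surjective π.toRingHom hπ)

end LocalizationMap

section Rank

variable {S F : Type*} [CommRing S] [IsDomain S] [AddCommGroup F] [Module S F]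
  [Module.Finite S F] {ι : Type*} [Fintype ι]

theorem linearIndependent_of_card_add_finrank_quotient_le {v : ι → F}
    (h : Fintype.card ι + Module.finrank S (F ⧸ Submodule.span S (Set.range v)) ≤
      Module.finrank S F) : LinearIndependent S v := by
  have hspan := (Submodule.span S (Set.range v)).finrank_quotient_add_finrank
  rw [← Fintype.range_linearCombination, ← Submodule.map_top] at hspan h
  rw [linearIndependent_iff_injective_fintypeLinearCombination, ← LinearMap.ker_eq_bot,
    ← disjoint_top, disjoint_comm]
  refine Submodule.disjoint_ker_of_finrank_le _ ?_
  rw [finrank_top, Module.finrank_pi]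
  omega

end Rank

section Kaehler

variable {R L S : Type*} [CommRing R] [CommRing L] [Algebra R L] [CommRing S] [Algebra R S]
  [Algebra L S] [IsScalarTower R L S]

theorem ker_mapBaseChange_eq_span (hsurj : Function.Surjective (algebraMap L S)) {s : Set L}
    (hs : RingHom.ker (algebraMap L S) = Ideal.span s) :
    (mapBaseChange R L S).ker = Submodule.span S ((fun x ↦ 1 ⊗ₜ[L] D R L x) '' s) := by
  have hsub : s ⊆ RingHom.ker (algebraMap L S) := hs ▸ Ideal.subset_span
  refine le_antisymm (fun z hz ↦ ?_) (Submodule.span_le.2 ?_)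
  · have htop : (⊤ : Submodule L (RingHom.ker (algebraMap L S))) =
        Submodule.span L (Subtype.val ⁻¹' s) := by
      rw [hs]
      exact Submodule.span_span_coe_preimage.symm
    have hle : ⊤ ≤ ((Submodule.span S ((fun x ↦ 1 ⊗ₜ[L] D R L x) '' s)).restrictScalars L).comap
        (kerToTensor R L S) := by
      rw [htop, Submodule.span_le]
      exact fun x hx ↦ Submodule.subset_span ⟨x, hx, rfl⟩
    obtain ⟨c, rfl⟩ := (exact_kerCotangentToTensor_mapBaseChange R L S hsurj z).1 hz
    obtain ⟨c, rfl⟩ := Ideal.toCotangent_surjective _ c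
    exact hle (Submodule.mem_top (x := c))
  · rintro _ ⟨x, hx, rfl⟩
    simp [RingHom.mem_ker.1 (hsub hx)]

theorem eq_zero_of_smul_kaehler_eq_zero [IsDomain S] [Module.Free L Ω[L⁄R]]
    [Module.Finite L Ω[L⁄R]] (hsurj : Function.Surjective (algebraMap L S)) {rs : List L}
    (hker : RingHom.ker (algebraMap L S) = Ideal.ofList rs)
    (hrank : rs.length + Module.finrank S Ω[S⁄R] ≤ Module.finrank L Ω[L⁄R]) {a b : S}
    (hab : IsRegular S [a, b]) {ω : Ω[S⁄R]} (haω : a • ω = 0) (hbω : b • ω = 0) : ω = 0 := by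
  have : Nontrivial L := (algebraMap L S).domain_nontrivial
  let v (i : Fin rs.length) : S ⊗[L] Ω[L⁄R] := 1 ⊗ₜ D R L rs[i]
  have hker' : (mapBaseChange R L S).ker = Submodule.span S (Set.range v) := by
    rw [ker_mapBaseChange_eq_span hsurj hker]
    congr 1
    ext
    simp [v, List.mem_iff_getElem, Fin.exists_iff]
  have hv : LinearIndependent S v := by
    refine linearIndependent_of_card_add_finrank_quotient_le ?_
    rwa [← hker', Fintype.card_fin, Module.finrank_baseChange,
      ((mapBaseChange R L S).quotKerEquivOfSurjective
        (mapBaseChange_surjective R L S hsurj)).finrank_eq]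
  obtain ⟨x, rfl⟩ := mapBaseChange_surjective R L S hsurj ω
  rw [← map_smul, ← LinearMap.mem_ker, hker', ← Fintype.range_linearCombination] at haω hbω
  rw [← LinearMap.mem_ker, hker', ← Fintype.range_linearCombination]
  refine mem_range_of_smul_mem_range
    (linearIndependent_iff_injective_fintypeLinearCombination.1 hv)
    (isWeaklyRegular_pair_pi hab.1) ?_ haω hbω
  exact Module.Flat.isSMulRegular_of_isRegular
    (isLeftRegular_iff_isRegular.1 (isWeaklyRegular_pair_iff.1 hab.1).1)

end Kaehler

section Basis

variable (k σ S : Type*) [CommRing k] [CommRing S] [Algebra k S] [Algebra (MvPolynomial σ k) S]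
  [IsScalarTower k (MvPolynomial σ k) S] [Algebra.FormallyEtale (MvPolynomial σ k) S]

/-- The basis `dxᵢ` of the differentials of an algebra with formally étale coordinates `xᵢ`. -/
noncomputable def kaehlerBasisOfFormallyEtale : Module.Basis σ S Ω[S⁄k] :=
  ((mvPolynomialBasis k σ).baseChange S).map
    (tensorKaehlerEquivOfFormallyEtale k (MvPolynomial σ k) S)

end Basis

section FinrankKaehler

theorem finrank_kaehler_le_of_isAlgebraic (k : Type*) {σ : Type*} [Finite σ] (K : Type*) [Field k]
    [CharZero k] [Field K] [Algebra k K]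
    [Algebra (MvPolynomial σ k) K] [IsScalarTower k (MvPolynomial σ k) K]
    [FaithfulSMul (MvPolynomial σ k) K] [Algebra.IsAlgebraic (MvPolynomial σ k) K] :
    Module.finrank K Ω[K⁄k] ≤ Nat.card σ := by
  have := Fintype.ofFinite σ
  let U := MvPolynomial σ k
  let := FractionRing.liftAlgebra U K
  have := FractionRing.isScalarTower_liftAlgebra U K
  have : Algebra.IsAlgebraic (FractionRing U) K :=
    (IsFractionRing.comap_isAlgebraic_iff (A := U)).1 inferInstance
  have : CharZero (FractionRing U) := IsFractionRing.charZero U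
  have : Algebra.FormallyUnramified (FractionRing U) K := .of_isSeparable _ _
  have : Algebra.FormallyUnramified U (FractionRing U) := .of_isLocalization (nonZeroDivisors U)
  have : Algebra.FormallyUnramified U K := .comp U (FractionRing U) K
  have hsurj : Function.Surjective (mapBaseChange k U K) := by
    rw [← LinearMap.range_eq_top, range_mapBaseChange, ← top_le_iff]
    exact fun x _ ↦ Subsingleton.elim _ _
  have hbasis := mvPolynomialBasis k σ
  have : Module.Free U Ω[U⁄k] := .of_basis hbasis
  have : Module.Finite U Ω[U⁄k] := .of_basis hbasis
  refine (LinearMap.finrank_le_finrank_of_surjective hsurj).trans_eq ?_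
  rw [Module.finrank_baseChange, Module.finrank_eq_card_basis hbasis, Nat.card_eq_fintype_card]

theorem finrank_kaehler_localization (k : Type*) {A : Type*} [CommRing k] [CommRing A]
    [Algebra k A] (B : Type*) [CommRing B] [Algebra k B] [Algebra A B] [IsScalarTower k A B]
    {M : Submonoid A} (hM : M ≤ nonZeroDivisors A) [IsLocalization M B] :
    Module.finrank B Ω[B⁄k] = Module.finrank A Ω[A⁄k] := by
  rw [Module.finrank, IsLocalization.rank_eq B M hM, ← Module.finrank,
    IsLocalizedModule.finrank_eq M (KaehlerDifferential.map k k A B) hM]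

variable (k A : Type*) [Field k] [IsAlgClosed k] [CharZero k] [CommRing A] [IsDomain A]
  [Algebra k A] [Algebra.FiniteType k A]

theorem finrank_kaehler_le_ringKrullDim : Module.finrank A Ω[A⁄k] ≤ ringKrullDim A := by
  obtain ⟨d, φ, hinj, hint, hdim, -⟩ := exists_normalization_forall_height_eq k A
  let U := MvPolynomial (Fin d) k
  let K := FractionRing A
  let : Algebra U A := φ.toRingHom.toAlgebra
  have : IsScalarTower k U A := .of_algHom φ
  have : Algebra.IsIntegral U A := ⟨hint⟩
  have : FaithfulSMul U A := (faithfulSMul_iff_algebraMap_injective _ _).2 hinj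
  have : Algebra.IsAlgebraic U K := (IsFractionRing.isAlgebraic_iff' U A K).1 inferInstance
  have : FaithfulSMul U K := (faithfulSMul_iff_algebraMap_injective _ _).2 <| by
    rw [IsScalarTower.algebraMap_eq U A K]
    exact (IsFractionRing.injective A K).comp hinj
  have h := finrank_kaehler_le_of_isAlgebraic k (σ := Fin d) K
  rw [finrank_kaehler_localization k K le_rfl (A := A) (M := nonZeroDivisors A), Nat.card_fin] at h
  rw [hdim]
  exact_mod_cast h

end FinrankKaehler

section CompleteIntersection

theorem length_add_ringKrullDim_eq {k : Type*} [Field k] [IsAlgClosed k] {n : ℕ}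
    (q : Ideal (MvPolynomial (Fin n) k)) [q.IsMaximal] {S : Type*} [CommRing S]
    {ψ : Localization.AtPrime q →+* S} (hψ : Function.Surjective ψ)
    {rs : List (Localization.AtPrime q)} (hrs : IsRegular (Localization.AtPrime q) rs)
    (hker : RingHom.ker ψ = Ideal.ofList rs) : rs.length + ringKrullDim S = n := by
  have h := ringKrullDim_add_length_eq_ringKrullDim_of_isRegular rs hrs
  rw [← hker, ringKrullDim_eq_of_ringEquiv (RingHom.quotientKerEquivOfSurjective hψ),
    IsLocalization.AtPrime.ringKrullDim_eq_height q (Localization.AtPrime q),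
    height_mvPolynomial_eq, add_comm] at h
  exact h

namespace IsLocallyCompleteIntersection

variable {A : Type*} [CommRing A] [Algebra ℂ A]

theorem exists_algHom_localization (hlci : IsLocallyCompleteIntersection A) (m : Ideal A)
    [hm : m.IsMaximal] : ∃ (n : ℕ) (q : Ideal (MvPolynomial (Fin n) ℂ)) (_ : q.IsMaximal)
      (ψ : Localization.AtPrime q →ₐ[ℂ] Localization.AtPrime m)
      (rs : List (Localization.AtPrime q)),
      Function.Surjective ψ ∧ IsRegular (Localization.AtPrime q) rs ∧
        RingHom.ker ψ = Ideal.ofList rs := by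
  obtain ⟨n, π, hπ, H⟩ := hlci
  obtain ⟨rs, hrs, hgen⟩ := H ⟨m, hm⟩
  exact ⟨n, m.comap π, Ideal.comap_isMaximal_of_surjective π hπ,
    Localization.localAlgHom _ m π rfl, rs, localAlgHom_comap_surjective hπ m, hrs,
    (ker_localAlgHom_comap hπ m).trans hgen.symm⟩

theorem exists_isRegular_pair [IsDomain A] [Algebra.FiniteType ℂ A]
    (hlci : IsLocallyCompleteIntersection A) (hdim : 2 ≤ ringKrullDim A) (m : Ideal A)
    [m.IsMaximal] : ∃ a b : Localization.AtPrime m, IsRegular (Localization.AtPrime m) [a, b] ∧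
      ∀ ω : Ω[Localization.AtPrime m⁄ℂ], a • ω = 0 → b • ω = 0 → ω = 0 := by
  obtain ⟨n, q, hq, ψ, rs, hψ, hrs, hker⟩ := hlci.exists_algHom_localization m
  have hlen : rs.length + ringKrullDim A = n :=
    ringKrullDim_localization_eq ℂ m ▸ length_add_ringKrullDim_eq q hψ hrs hker
  obtain ⟨xs, hxs_length, hxs⟩ := exists_isRegular_localization q
  have hdepth : rs.length + 2 ≤ xs.length := by
    have : (rs.length : WithBot ℕ∞) + 2 ≤ n := hlen ▸ by gcongr
    rw [hxs_length]
    exact_mod_cast this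
  have hrank : rs.length + Module.finrank A Ω[A⁄ℂ] ≤ n := by
    have : (rs.length : WithBot ℕ∞) + Module.finrank A Ω[A⁄ℂ] ≤ n :=
      hlen ▸ by gcongr; exact finrank_kaehler_le_ringKrullDim ℂ A
    exact_mod_cast this
  algebraize [ψ.toRingHom]
  have : IsScalarTower ℂ (Localization.AtPrime q) (Localization.AtPrime m) := .of_algHom ψ
  obtain ⟨ss, hss, hreg⟩ := exists_isRegular_of_ker_eq_ofList hψ hxs hrs hker hdepth
  obtain ⟨a, b, rfl⟩ := List.length_eq_two.1 hss
  have : Algebra.FormallyEtale (MvPolynomial (Fin n) ℂ) (Localization.AtPrime q) :=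
    .of_isLocalization q.primeCompl
  let basis := kaehlerBasisOfFormallyEtale ℂ (Fin n) (Localization.AtPrime q)
  have : Module.Free _ Ω[Localization.AtPrime q⁄ℂ] := .of_basis basis
  have : Module.Finite _ Ω[Localization.AtPrime q⁄ℂ] := .of_basis basis
  refine ⟨a, b, hreg, fun ω ↦ eq_zero_of_smul_kaehler_eq_zero (L := Localization.AtPrime q)
    hψ hker ?_ hreg⟩
  rwa [finrank_kaehler_localization ℂ _ m.primeCompl_le_nonZeroDivisors,
    Module.finrank_eq_card_basis basis, Fintype.card_fin]

end IsLocallyCompleteIntersection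

end CompleteIntersection

/-! ### Vanishing outside finitely many closed points -/

section FinitelyManyClosedPoints

variable {A : Type*} [CommRing A] [IsJacobsonRing A] {E : Set (MaximalSpectrum A)}

theorem isMaximal_of_finite_of_forall_mem (hE : E.Finite) (p : Ideal A) [hp : p.IsPrime]
    (h : ∀ m : MaximalSpectrum A, p ≤ m.asIdeal → m ∈ E) : p.IsMaximal := by
  classical
  have hinf : (hE.toFinset.filter fun m ↦ p ≤ m.asIdeal).inf MaximalSpectrum.asIdeal ≤ p := by
    intro x hx
    rw [← isJacobsonRing_iff_prime_eq.1 inferInstance p hp]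
    refine Ideal.mem_sInf.2 fun {m} hm ↦ ?_
    have hmem : (⟨m, hm.2⟩ : MaximalSpectrum A) ∈ hE.toFinset.filter fun m ↦ p ≤ m.asIdeal :=
      Finset.mem_filter.2 ⟨hE.mem_toFinset.2 (h ⟨m, hm.2⟩ hm.1), hm.1⟩
    exact Finset.inf_le (f := MaximalSpectrum.asIdeal) hmem hx
  obtain ⟨m, hm, hmp⟩ := hp.inf_le'.1 hinf
  exact le_antisymm (Finset.mem_filter.1 hm).2 hmp ▸ m.isMaximal

theorem eq_zero_of_finite_of_forall_notMem_exists_smul_eq_zero [IsNoetherianRing A] {N : Type*}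
    [AddCommGroup N] [Module A N] (hN : ∀ m : Ideal A, m.IsMaximal → m ∉ associatedPrimes A N)
    (hE : E.Finite) {z : N} (hz : ∀ m ∉ E, ∃ s ∉ m.asIdeal, s • z = 0) : z = 0 := by
  by_contra hne
  obtain ⟨P, hP, hle⟩ := exists_le_isAssociatedPrime_of_isNoetherianRing A z hne
  have := hP.isPrime
  refine hN P (isMaximal_of_finite_of_forall_mem hE P fun m hPm ↦ ?_) hP
  by_contra hmE
  obtain ⟨s, hs, hsz⟩ := hz m hmE
  exact hs (hPm (hle (Submodule.mem_colon_singleton.2 hsz)))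

end FinitelyManyClosedPoints

section Depth

variable {A : Type*} [CommRing A] [IsNoetherianRing A]

open Module in
theorem notMem_associatedPrimes_of_isLocalizedModule {N N' : Type*} [AddCommGroup N] [Module A N]
    (m : Ideal A) [m.IsPrime] [AddCommGroup N'] [Module A N'] [Module (Localization.AtPrime m) N']
    [IsScalarTower A (Localization.AtPrime m) N'] (f : N →ₗ[A] N')
    [IsLocalizedModule m.primeCompl f] {a b : Localization.AtPrime m}
    (hab : IsRegular (Localization.AtPrime m) [a, b])
    (h : ∀ x : N', a • x = 0 → b • x = 0 → x = 0) : m ∉ associatedPrimes A N := by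
  intro hm
  have hloc : maximalIdeal (Localization.AtPrime m) ∈
      associatedPrimes (Localization.AtPrime m) N' := by
    apply associatedPrimes.mem_associatedPrimes_of_comap_mem_associatedPrimes_of_isLocalizedModule
      m.primeCompl f
    rwa [← Ideal.under_def, Localization.AtPrime.under_maximalIdeal]
  have : IsNoetherianRing (Localization.AtPrime m) :=
    IsLocalization.isNoetherianRing m.primeCompl _ inferInstance
  obtain ⟨hprime, x, hx⟩ := isAssociatedPrime_iff.1 hloc
  have hkill (c) (hc : c ∈ [a, b]) : c • x = 0 :=
    Submodule.mem_colon_singleton.1 (hx ▸ mem_maximalIdeal_of_isRegular hab hc)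
  have hx0 : x = 0 := h x (hkill a (by simp)) (hkill b (by simp))
  exact hprime.ne_top (by rw [hx, hx0, Submodule.colon_singleton_zero])

end Depth

namespace IsLocallyCompleteIntersection

variable {A : Type*} [CommRing A] [IsDomain A] [Algebra ℂ A] [Algebra.FiniteType ℂ A]

theorem notMem_associatedPrimes_kaehlerDifferential (hlci : IsLocallyCompleteIntersection A)
    (hdim : 2 ≤ ringKrullDim A) (m : Ideal A) [m.IsMaximal] :
    m ∉ associatedPrimes A Ω[A⁄ℂ] := by
  have : IsNoetherianRing A := Algebra.FiniteType.isNoetherianRing ℂ A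
  obtain ⟨a, b, hab, hΩ⟩ := hlci.exists_isRegular_pair hdim m
  exact notMem_associatedPrimes_of_isLocalizedModule m
    (KaehlerDifferential.map ℂ ℂ A (Localization.AtPrime m)) hab hΩ

theorem notMem_associatedPrimes_quotient_span (hlci : IsLocallyCompleteIntersection A)
    (hdim : 2 ≤ ringKrullDim A) {t : A} (ht : t ≠ 0) (m : Ideal A) [m.IsMaximal] :
    m ∉ associatedPrimes A (A ⧸ Ideal.span {t}) := by
  have : IsNoetherianRing A := Algebra.FiniteType.isNoetherianRing ℂ A
  obtain ⟨a, b, hab, -⟩ := hlci.exists_isRegular_pair hdim m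
  set τ := algebraMap A (Localization.AtPrime m) t with hτ_def
  have hτ : τ ≠ 0 := (map_ne_zero_iff _ (IsLocalization.injective _
    m.primeCompl_le_nonZeroDivisors)).2 ht
  let T := LinearMap.mulLeft (Localization.AtPrime m) τ
  have hT : (Ideal.span {t}).localized' (Localization.AtPrime m) m.primeCompl
      (Algebra.linearMap A (Localization.AtPrime m)) = T.range := by
    rw [Ideal.span, Submodule.localized'_span, Set.image_singleton]
    ext x
    simp only [Algebra.linearMap_apply, Submodule.mem_span_singleton, smul_eq_mul,
      LinearMap.mem_range, T, LinearMap.mulLeft_apply, mul_comm, ← hτ_def]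
  refine notMem_associatedPrimes_of_isLocalizedModule m (Submodule.toLocalizedQuotient'
    (Localization.AtPrime m) m.primeCompl (Algebra.linearMap A (Localization.AtPrime m)) _) hab ?_
  intro x hax hbx
  obtain ⟨x, rfl⟩ := Submodule.Quotient.mk_surjective _ x
  rw [← Submodule.Quotient.mk_smul, Submodule.Quotient.mk_eq_zero, hT] at hax hbx
  rw [Submodule.Quotient.mk_eq_zero, hT]
  exact mem_range_of_smul_mem_range (mul_right_injective₀ hτ) hab.1
    (isWeaklyRegular_pair_iff.1 hab.1).1 hax hbx

theorem kaehler_eq_zero_of_forall_notMem_exists_smul_eq_zero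
    (hlci : IsLocallyCompleteIntersection A) (hdim : 2 ≤ ringKrullDim A)
    {E : Set (MaximalSpectrum A)} (hE : E.Finite) {ω : Ω[A⁄ℂ]}
    (hω : ∀ m ∉ E, ∃ s ∉ m.asIdeal, s • ω = 0) : ω = 0 := by
  have : IsNoetherianRing A := Algebra.FiniteType.isNoetherianRing ℂ A
  have : IsJacobsonRing A := isJacobsonRing_of_finiteType (A := ℂ)
  exact eq_zero_of_finite_of_forall_notMem_exists_smul_eq_zero
    (fun m _ ↦ hlci.notMem_associatedPrimes_kaehlerDifferential hdim m) hE hω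

theorem mem_span_singleton_of_forall_notMem_exists_mul_mem
    (hlci : IsLocallyCompleteIntersection A) (hdim : 2 ≤ ringKrullDim A) {t : A} (ht : t ≠ 0)
    {E : Set (MaximalSpectrum A)} (hE : E.Finite) {z : A}
    (hz : ∀ m ∉ E, ∃ s ∉ m.asIdeal, s * z ∈ Ideal.span {t}) : z ∈ Ideal.span {t} := by
  have : IsNoetherianRing A := Algebra.FiniteType.isNoetherianRing ℂ A
  have : IsJacobsonRing A := isJacobsonRing_of_finiteType (A := ℂ)
  rw [← Ideal.Quotient.eq_zero_iff_mem]
  refine eq_zero_of_finite_of_forall_notMem_exists_smul_eq_zero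
    (fun m _ ↦ hlci.notMem_associatedPrimes_quotient_span hdim ht m) hE fun m hm ↦ ?_
  obtain ⟨s, hs, hsz⟩ := hz m hm
  exact ⟨s, hs, Ideal.Quotient.eq_zero_iff_mem.2 hsz⟩

end IsLocallyCompleteIntersection

/-! ### Smooth points of a hypersurface -/

section Coordinate

variable {A : Type*} [CommRing A]

theorem map_notMem_maximalIdeal_smul_top {N N' : Type*} [AddCommGroup N] [Module A N] (m : Ideal A)
    [hm : m.IsMaximal] [AddCommGroup N'] [Module A N'] [Module (Localization.AtPrime m) N']
    [IsScalarTower A (Localization.AtPrime m) N'] (f : N →ₗ[A] N')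
    [IsLocalizedModule m.primeCompl f] {x : N} (hx : x ∉ m • (⊤ : Submodule A N)) :
    f x ∉ maximalIdeal (Localization.AtPrime m) • (⊤ : Submodule (Localization.AtPrime m) N') := by
  rw [← Localization.AtPrime.map_eq_maximalIdeal,
    ← Submodule.localized'_top (Localization.AtPrime m) m.primeCompl f,
    ← Ideal.localized'_eq_map _ m.primeCompl, ← Submodule.localized'_smul,
    Submodule.mem_localized']
  rintro ⟨θ, hθ, s, h⟩
  rw [IsLocalizedModule.mk'_eq_iff, Submonoid.smul_def, ← map_smul] at h
  obtain ⟨u, hu⟩ := IsLocalizedModule.exists_of_eq (S := m.primeCompl) h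
  have husx : (u * s : A) • x ∈ m • (⊤ : Submodule A N) := by
    rw [mul_smul]
    exact hu ▸ Submodule.smul_mem _ _ hθ
  obtain ⟨r, i, hi, hri⟩ := hm.exists_inv (m.primeCompl.mul_mem u.2 s.2)
  refine hx ?_
  rw [← one_smul A x, ← hri, add_smul, mul_smul]
  exact add_mem (Submodule.smul_mem _ _ husx) (Submodule.smul_mem_smul hi trivial)

theorem exists_linearMap_apply_eq_one {R M : Type*} [CommRing R] [IsLocalRing R] [AddCommGroup M]
    [Module R M] [Module.Free R M] {x : M} (hx : x ∉ maximalIdeal R • (⊤ : Submodule R M)) :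
    ∃ φ : M →ₗ[R] R, φ x = 1 := by
  let β := Module.Free.chooseBasis R M
  obtain ⟨i, hi⟩ : ∃ i, β.repr x i ∉ maximalIdeal R := by
    by_contra! hall
    refine hx ?_
    rw [← β.linearCombination_repr x]
    exact Submodule.sum_mem _ fun i _ ↦ Submodule.smul_mem_smul (hall i) trivial
  obtain ⟨c, hc⟩ := (notMem_maximalIdeal.1 hi).exists_left_inv
  exact ⟨c • β.coord i, hc⟩

variable (k : Type*) [CommRing k] [Algebra k A] [Algebra.EssFiniteType k A]

theorem free_kaehler_of_isSmoothAt (m : Ideal A) [m.IsPrime] [Algebra.IsSmoothAt k m] :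
    Module.Free (Localization.AtPrime m) Ω[Localization.AtPrime m⁄k] := by
  have : Algebra.FormallySmooth k (Localization.AtPrime m) := ‹Algebra.IsSmoothAt k m›
  have : Algebra.EssFiniteType k (Localization.AtPrime m) := .comp k A _
  exact Module.free_of_flat_of_isLocalRing

variable {k}

theorem exists_linearMap_D_eq_one (m : Ideal A) [m.IsMaximal] [Algebra.IsSmoothAt k m] {t : A}
    (ht : D k A t ∉ m • (⊤ : Submodule A Ω[A⁄k])) :
    ∃ φ : Ω[Localization.AtPrime m⁄k] →ₗ[Localization.AtPrime m] Localization.AtPrime m,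
      φ (D k _ (algebraMap A _ t)) = 1 := by
  have := free_kaehler_of_isSmoothAt k m
  rw [← KaehlerDifferential.map_D k k A]
  exact exists_linearMap_apply_eq_one
    (map_notMem_maximalIdeal_smul_top m (KaehlerDifferential.map k k A _) ht)

theorem exists_smul_eq_zero_of_isSmoothAt [IsDomain A] (m : Ideal A) [m.IsPrime]
    [Algebra.IsSmoothAt k m] {t : A} (ht : t ≠ 0) {ω : Ω[A⁄k]} (hω : t • ω = 0) :
    ∃ s ∉ m, s • ω = 0 := by
  have := free_kaehler_of_isSmoothAt k m
  have hτ : algebraMap A (Localization.AtPrime m) t ≠ 0 := (map_ne_zero_iff _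
    (IsLocalization.injective _ m.primeCompl_le_nonZeroDivisors)).2 ht
  let f := KaehlerDifferential.map k k A (Localization.AtPrime m)
  have hfω : algebraMap A (Localization.AtPrime m) t • f ω = 0 := by
    rw [algebraMap_smul, ← map_smul, hω, map_zero]
  obtain ⟨s, hs⟩ := (IsLocalizedModule.eq_zero_iff m.primeCompl f).1
    ((smul_eq_zero.1 hfω).resolve_left hτ)
  exact ⟨s, s.2, hs⟩

theorem exists_mul_mem_span_of_algebraMap_mem {p : Ideal A} [p.IsPrime] {t z : A}
    (h : algebraMap A (Localization.AtPrime p) z ∈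
      Ideal.span {algebraMap A (Localization.AtPrime p) t}) :
    ∃ s ∉ p, s * z ∈ Ideal.span {t} := by
  rw [← Set.image_singleton, ← Ideal.map_span] at h
  obtain ⟨s, hs, hsz⟩ := (IsLocalization.algebraMap_mem_map_algebraMap_iff p.primeCompl _ _ _).1 h
  exact ⟨s, hs, hsz⟩

theorem exists_mul_mem_span_of_smul_D_eq (m : Ideal A) [m.IsMaximal] [Algebra.IsSmoothAt k m]
    {t : A} (ht : D k A t ∉ m • (⊤ : Submodule A Ω[A⁄k])) {a : A} {ω : Ω[A⁄k]}
    (h : a • D k A t = t • ω) : ∃ s ∉ m, s * a ∈ Ideal.span {t} := by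
  obtain ⟨φ, hφ⟩ := exists_linearMap_D_eq_one m ht
  refine exists_mul_mem_span_of_algebraMap_mem (Ideal.mem_span_singleton'.2
    ⟨φ (KaehlerDifferential.map k k A _ ω), ?_⟩)
  have hφh := congrArg (fun η ↦ φ (KaehlerDifferential.map k k A _ η)) h
  simp only [map_smul, KaehlerDifferential.map_D] at hφh
  rw [← algebraMap_smul (Localization.AtPrime m) a, ← algebraMap_smul (Localization.AtPrime m) t,
    map_smul, map_smul, hφ, smul_eq_mul, mul_one, smul_eq_mul] at hφh
  rw [hφh, mul_comm]

end Coordinate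

section Reduced

theorem isReduced_of_etale (P B : Type*) [CommRing P] [IsDomain P] [CommRing B] [Algebra P B]
    [Algebra.Etale P B] : IsReduced B := by
  have : Algebra.EssFiniteType (FractionRing P) (FractionRing P ⊗[P] B) := inferInstance
  have : IsReduced (FractionRing P ⊗[P] B) :=
    Algebra.FormallyUnramified.isReduced_of_field (FractionRing P) _
  exact isReduced_of_injective (Algebra.TensorProduct.includeRight : B →ₐ[P] FractionRing P ⊗[P] B)
    (Algebra.TensorProduct.includeRight_injective (IsFractionRing.injective P _))

theorem exists_mul_eq_zero_of_isNilpotent_of_isSmoothAt (k : Type*) {B : Type*} [CommRing k]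
    [IsDomain k] [CommRing B] [Algebra k B] [Algebra.FinitePresentation k B] (p : Ideal B)
    [p.IsPrime] [Algebra.IsSmoothAt k p] {z : B} (hz : IsNilpotent z) : ∃ s ∉ p, s * z = 0 := by
  obtain ⟨g, hg, n, _, _, _⟩ :=
    Algebra.IsSmoothAt.exists_isStandardEtale_mvPolynomial (R := k) (p := p)
  have : IsReduced (Localization.Away g) := isReduced_of_etale (MvPolynomial (Fin n) k) _
  obtain ⟨⟨_, j, rfl⟩, hj⟩ := (IsLocalization.map_eq_zero_iff (Submonoid.powers g) _ z).1
    (hz.map (algebraMap B (Localization.Away g))).eq_zero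
  exact ⟨g ^ j, fun h ↦ hg (Ideal.IsPrime.mem_of_pow_mem inferInstance j h), hj⟩

end Reduced

section Hypersurface

theorem exists_linearMap_algebraMap_eq_smul {L S M : Type*} [CommRing L] [CommRing S] [Algebra L S]
    [AddCommGroup M] [Module L M] (hsurj : Function.Surjective (algebraMap L S)) {τ : M}
    (hτ : ∀ x ∈ RingHom.ker (algebraMap L S), x • τ = 0) :
    ∃ g : S →ₗ[L] M, ∀ x, g (algebraMap L S x) = x • τ := by
  let e := (Algebra.linearMap L S).quotKerEquivOfSurjective hsurj
  refine ⟨(Algebra.linearMap L S).ker.liftQ (LinearMap.toSpanSingleton L M τ)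
    (fun x hx ↦ hτ x hx) ∘ₗ e.symm, fun x ↦ ?_⟩
  have hx : e.symm (algebraMap L S x) = Submodule.Quotient.mk x := e.symm_apply_eq.2 rfl
  rw [LinearMap.comp_apply, LinearEquiv.coe_coe, hx]
  rfl

theorem formallySmooth_of_ker_eq_span {k L S : Type*} [CommRing k] [CommRing L] [CommRing S]
    [Algebra k L] [Algebra k S] [Algebra L S] [IsScalarTower k L S] [Algebra.FormallySmooth k L]
    (hsurj : Function.Surjective (algebraMap L S)) {t : L}
    (hker : RingHom.ker (algebraMap L S) = Ideal.span {t}) {φ : Ω[L⁄k] →ₗ[L] L}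
    (hφ : φ (D k L t) = 1) : Algebra.FormallySmooth k S := by
  rw [Algebra.FormallySmooth.iff_split_injection hsurj]
  have ht : t ∈ RingHom.ker (algebraMap L S) := hker ▸ Ideal.mem_span_singleton_self t
  let τ : (RingHom.ker (algebraMap L S)).Cotangent := Ideal.toCotangent _ ⟨t, ht⟩
  have hτ : ∀ x ∈ RingHom.ker (algebraMap L S), x • τ = 0 := fun x hx ↦ by
    rw [← map_smul, Ideal.toCotangent_eq_zero, pow_two]
    exact Ideal.mul_mem_mul hx ht
  obtain ⟨g, hg⟩ := exists_linearMap_algebraMap_eq_smul hsurj hτ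
  -- The retraction sends `s ⊗ ω` to `φ ω • s • τ`, where `τ` is the class of `t` in `I / I²`.
  refine ⟨g ∘ₗ (TensorProduct.rid L S).toLinearMap ∘ₗ φ.lTensor S, ?_⟩
  ext c
  obtain ⟨⟨c, hc⟩, rfl⟩ := Ideal.toCotangent_surjective _ c
  obtain ⟨d, rfl⟩ := Ideal.mem_span_singleton'.1 (hker ▸ hc)
  have hφd : φ (D k L (d * t)) = d + t * φ (D k L d) := by
    rw [Derivation.leibniz, map_add, map_smul, map_smul, hφ, smul_eq_mul, smul_eq_mul, mul_one]
  simp only [LinearMap.comp_apply, KaehlerDifferential.kerCotangentToTensor_toCotangent,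
    LinearMap.lTensor_tmul, LinearEquiv.coe_coe, TensorProduct.rid_tmul, LinearMap.id_apply]
  rw [hφd, ← Algebra.algebraMap_eq_smul_one, hg, add_smul, mul_comm t, mul_smul, hτ t ht,
    smul_zero, add_zero, ← map_smul]
  rfl

variable {k A : Type*} [CommRing k] [CommRing A] [Algebra k A]

theorem isSmoothAt_of_ker_eq_span [Algebra.EssFiniteType k A] {B : Type*} [CommRing B] [Algebra k B]
    {π : A →ₐ[k] B} (hπ : Function.Surjective π) {t : A} (hker : RingHom.ker π = Ideal.span {t})
    (p : Ideal B) [p.IsPrime] [(p.comap π).IsMaximal] [hsm : Algebra.IsSmoothAt k (p.comap π)]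
    (ht : D k A t ∉ p.comap π • (⊤ : Submodule A Ω[A⁄k])) : Algebra.IsSmoothAt k p := by
  obtain ⟨φ, hφ⟩ := exists_linearMap_D_eq_one _ ht
  let ψ := Localization.localAlgHom (p.comap π) p π rfl
  algebraize [ψ.toRingHom]
  have := IsScalarTower.of_algHom ψ
  have hkerψ : RingHom.ker ψ = Ideal.span {algebraMap A (Localization.AtPrime (p.comap π)) t} := by
    rw [ker_localAlgHom_comap hπ p, hker, Ideal.map_span, Set.image_singleton]
  have : Algebra.FormallySmooth k (Localization.AtPrime (p.comap π)) := hsm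
  exact formallySmooth_of_ker_eq_span (localAlgHom_comap_surjective hπ p) hkerψ hφ

theorem exists_mul_mem_span_of_mem_radical [IsDomain k] [IsNoetherianRing k]
    [Algebra.FiniteType k A] (m : Ideal A) [m.IsMaximal] [hsm : Algebra.IsSmoothAt k m] {t : A}
    (htm : t ∈ m) (ht : D k A t ∉ m • (⊤ : Submodule A Ω[A⁄k])) {z : A}
    (hz : z ∈ (Ideal.span {t}).radical) : ∃ s ∉ m, s * z ∈ Ideal.span {t} := by
  let π := Ideal.Quotient.mkₐ k (Ideal.span {t})
  have hπ : Function.Surjective π := Ideal.Quotient.mkₐ_surjective k _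
  have hker : RingHom.ker π = Ideal.span {t} := Ideal.mk_ker
  have hle : RingHom.ker π ≤ m := by rwa [hker, Ideal.span_singleton_le_iff_mem]
  have hcomap : (m.map π).comap π = m := by
    rwa [Ideal.comap_map_of_surjective' π hπ, sup_eq_left]
  have hp : (m.map π).IsPrime := Ideal.map_isPrime_of_surjective hπ hle
  generalize m.map π = p at hp hcomap
  subst hcomap
  have := isSmoothAt_of_ker_eq_span hπ hker p ht
  have : Algebra.FinitePresentation k (A ⧸ Ideal.span {t}) :=
    Algebra.FinitePresentation.of_finiteType.1 inferInstance
  obtain ⟨n, hn⟩ := hz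
  have hnil : IsNilpotent (π z) := ⟨n, Ideal.Quotient.eq_zero_iff_mem.2 hn⟩
  obtain ⟨s, hs, hsz⟩ := exists_mul_eq_zero_of_isNilpotent_of_isSmoothAt k p hnil
  obtain ⟨s, rfl⟩ := hπ s
  exact ⟨s, hs, Ideal.Quotient.eq_zero_iff_mem.1 hsz⟩

end Hypersurface

/-! ### Functions with vanishing differential -/

section Constants

theorem mapBaseChange_injective (R S T : Type*) [CommRing R] [CommRing S] [CommRing T] [Algebra R S]
    [Algebra R T] [Algebra S T] [IsScalarTower R S T] [Algebra.FormallySmooth S T] :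
    Function.Injective (mapBaseChange R S T) := by
  rw [injective_iff_map_eq_zero]
  intro z hz
  obtain ⟨h, rfl⟩ := (Algebra.H1Cotangent.exact_δ_mapBaseChange R S T z).1 hz
  rw [Subsingleton.elim h 0, map_zero]

variable {k : Type*} [Field k] [CharZero k]

open Polynomial in
theorem D_ne_zero_of_transcendental {K : Type*} [Field K] [Algebra k K] [Algebra.EssFiniteType k K]
    {x : K} (hx : Transcendental k x) : D k K x ≠ 0 := by
  algebraize [(aeval (R := k) x).toRingHom]
  have : IsScalarTower k k[X] K := .of_algHom (aeval x)
  have : FaithfulSMul k[X] K :=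
    (faithfulSMul_iff_algebraMap_injective _ _).2 (transcendental_iff_injective.1 hx)
  let F := FractionRing k[X]
  let _ := FractionRing.liftAlgebra k[X] K
  have := FractionRing.isScalarTower_liftAlgebra k[X] K
  have : IsScalarTower k F K := .to₁₃₄ k k[X] F K
  have : CharZero F := IsFractionRing.charZero k[X]
  have : Algebra.EssFiniteType F K := .of_comp k F K
  have : Algebra.FormallySmooth k[X] F := .of_isLocalization (nonZeroDivisors k[X])
  have : Algebra.FormallySmooth k[X] K := .comp k[X] F K
  intro hDx
  have hmap : mapBaseChange k k[X] K (1 ⊗ₜ D k k[X] X) = 0 := by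
    rw [mapBaseChange_tmul, KaehlerDifferential.map_D, one_smul]
    exact (congrArg (D k K) (aeval_X x)).trans hDx
  have htmul := (injective_iff_map_eq_zero _).1 (mapBaseChange_injective k k[X] K) _ hmap
  have hone := congrArg
    (fun z ↦ TensorProduct.rid k[X] K ((polynomialEquiv k).toLinearMap.lTensor K z)) htmul
  simp [polynomialEquiv_D] at hone

variable [IsAlgClosed k]

theorem exists_algebraMap_eq_of_D_eq_zero {K : Type*} [Field K] [Algebra k K]
    [Algebra.EssFiniteType k K] {x : K} (hx : D k K x = 0) : ∃ c : k, algebraMap k K c = x := by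
  have halg : IsAlgebraic k x := by
    by_contra hx'
    exact D_ne_zero_of_transcendental hx' hx
  exact minpoly.mem_range_of_degree_eq_one k x
    (IsAlgClosed.degree_eq_one_of_irreducible k (minpoly.irreducible halg.isIntegral))

variable {A : Type*} [CommRing A] [Algebra k A] [Algebra.EssFiniteType k A] {t g a : A} {ω : Ω[A⁄k]}

theorem exists_sub_algebraMap_mem_of_D_eq (h : D k A g = t • ω + a • D k A t) (p : Ideal A)
    [p.IsPrime] (ht : t ∈ p) : ∃ c : k, g - algebraMap k A c ∈ p := by
  have hκ : ∀ x, algebraMap A p.ResidueField x = 0 ↔ x ∈ p := fun _ ↦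
    Ideal.algebraMap_residueField_eq_zero
  have hDg : D k p.ResidueField (algebraMap A p.ResidueField g) = 0 := by
    rw [← KaehlerDifferential.map_D k k A, h, map_add, map_smul, map_smul,
      KaehlerDifferential.map_D, (hκ t).2 ht, map_zero, smul_zero, add_zero,
      ← algebraMap_smul p.ResidueField t, (hκ t).2 ht, zero_smul]
  have : Algebra.EssFiniteType k p.ResidueField := .comp k A _
  obtain ⟨c, hc⟩ := exists_algebraMap_eq_of_D_eq_zero hDg
  refine ⟨c, (hκ _).1 ?_⟩
  rw [map_sub, ← hc, ← IsScalarTower.algebraMap_apply, sub_self]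

open Polynomial in
theorem exists_separable_dvd_aeval_of_D_eq (hrad : (Ideal.span {t}).IsRadical)
    (h : D k A g = t • ω + a • D k A t) : ∃ p : k[X], p.Separable ∧ t ∣ aeval g p := by
  classical
  have : IsNoetherianRing A := Algebra.EssFiniteType.isNoetherianRing k A
  have hfin := Ideal.finite_minimalPrimes_of_isNoetherianRing A (Ideal.span {t})
  have hconst : ∀ P ∈ (Ideal.span {t}).minimalPrimes, ∃ c : k, g - algebraMap k A c ∈ P := by
    intro P hP
    have := hP.1.1
    exact exists_sub_algebraMap_mem_of_D_eq h P (hP.1.2 (Ideal.mem_span_singleton_self t))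
  choose! c hc using hconst
  refine ⟨∏ x ∈ hfin.toFinset.image c, (X - C x),
    separable_prod_X_sub_C_iff'.2 fun _ _ _ _ h ↦ h, ?_⟩
  refine Ideal.mem_span_singleton.1 (hrad ?_)
  rw [← Ideal.sInf_minimalPrimes, Ideal.mem_sInf]
  intro P hP
  rw [map_prod]
  refine P.mem_of_dvd (Finset.dvd_prod_of_mem _
    (Finset.mem_image_of_mem c (hfin.mem_toFinset.2 hP))) ?_
  simpa only [map_sub, aeval_X, aeval_C] using hc P hP

end Constants

/-! ### Newton iteration -/

section Newton

open Polynomial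

variable {R A : Type*} [CommRing R] [CommRing A] [Algebra R A] {p : R[X]}

theorem exists_sq_aeval_dvd_aeval (hp : p.Separable) (g : A) :
    ∃ g' : A, aeval g p ∣ g - g' ∧ aeval g p ^ 2 ∣ aeval g' p := by
  obtain ⟨u, v, huv⟩ := hp
  have huv' : aeval g u * aeval g p + aeval g v * aeval g (derivative p) = 1 := by
    rw [← map_mul, ← map_mul, ← map_add, huv, map_one]
  let δ := -(aeval g v * aeval g p)
  obtain ⟨c, hc⟩ := (p.map (algebraMap R A)).binomExpansion g δ
  rw [derivative_map, eval_map_algebraMap, eval_map_algebraMap, eval_map_algebraMap] at hc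
  refine ⟨g + δ, ⟨aeval g v, ?_⟩, aeval g u + c * aeval g v ^ 2, ?_⟩
  · ring
  · rw [hc]
    linear_combination (-aeval g p) * huv'

theorem exists_pow_dvd_aeval (hp : p.Separable) {t g : A} (hg : t ∣ aeval g p) (n : ℕ) :
    ∃ g' : A, t ∣ g - g' ∧ t ^ (n + 1) ∣ aeval g' p := by
  induction n with
  | zero => exact ⟨g, by simp, by simpa using hg⟩
  | succ n ih =>
    obtain ⟨g₁, hgg₁, hg₁⟩ := ih
    obtain ⟨g₂, hg₁g₂, hg₂⟩ := exists_sq_aeval_dvd_aeval hp g₁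
    refine ⟨g₂, ?_, ?_⟩
    · rw [← sub_add_sub_cancel g g₁ g₂]
      exact dvd_add hgg₁ ((dvd_pow_self t n.succ_ne_zero).trans (hg₁.trans hg₁g₂))
    · refine (pow_dvd_pow t ?_).trans (((pow_mul t (n + 1) 2).dvd.trans
        (pow_dvd_pow_of_dvd hg₁ 2)).trans hg₂)
      lia

theorem exists_D_eq_pow_smul_add_of_pow_dvd_aeval (hp : p.Separable) {t g : A} {n : ℕ}
    (hg : t ^ n ∣ aeval g p) :
    ∃ (η : Ω[A⁄R]) (a : A), D R A g = t ^ n • η + a • D R A t := by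
  obtain ⟨u, v, huv⟩ := hp
  obtain ⟨w, hw⟩ := hg
  have huv' : aeval g u * aeval g p + aeval g v * aeval g (derivative p) = 1 := by
    rw [← map_mul, ← map_mul, ← map_add, huv, map_one]
  have hD : aeval g (derivative p) • D R A g =
      t ^ n • D R A w + (w * (n * t ^ (n - 1))) • D R A t := by
    rw [← Derivation.map_aeval, hw, Derivation.leibniz, Derivation.leibniz_pow]
    simp only [smul_smul, ← Nat.cast_smul_eq_nsmul A]
  refine ⟨(aeval g u * w) • D R A g + aeval g v • D R A w,
    aeval g v * (w * (n * t ^ (n - 1))), ?_⟩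
  calc D R A g = (aeval g u * (t ^ n * w)) • D R A g +
        aeval g v • aeval g (derivative p) • D R A g := by
        rw [smul_smul, ← add_smul, ← hw, huv', one_smul]
    _ = _ := by
        rw [hD]
        module

end Newton

section Division

open Polynomial

variable {R A : Type*} [CommRing R] [CommRing A] [Algebra R A] {t : A}

theorem exists_pow_smul_sub_eq_of_pow_succ_smul_eq (hreg : IsSMulRegular Ω[A⁄R] t)
    (hdvd : ∀ (a : A) (ω : Ω[A⁄R]), a • D R A t = t • ω → t ∣ a)
    {p : R[X]} (hp : p.Separable) {g a : A} (hg : t ∣ aeval g p) {r : ℕ} {ω : Ω[A⁄R]}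
    (h : t ^ (r + 1) • ω = D R A g + a • D R A t) :
    ∃ (η : Ω[A⁄R]) (g' a' : A), t ^ r • (ω - t • η) = D R A g' + a' • D R A t := by
  obtain ⟨g₁, ⟨w, hw⟩, hg₁⟩ := exists_pow_dvd_aeval hp hg (r + 1)
  obtain ⟨η, c, hη⟩ := exists_D_eq_pow_smul_add_of_pow_dvd_aeval hp hg₁
  have hDg : D R A g = t ^ (r + 2) • η + c • D R A t + (t • D R A w + w • D R A t) := by
    rw [← hη, ← Derivation.leibniz, ← map_add, ← hw, add_sub_cancel]
  have hDt : (-(c + w + a)) • D R A t = t • (D R A w - t ^ r • (ω - t • η)) := by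
    rw [hDg] at h
    linear_combination (norm := module) h
  obtain ⟨b, hb⟩ := hdvd _ _ hDt
  rw [hb, mul_smul] at hDt
  refine ⟨η, w, -b, ?_⟩
  linear_combination (norm := module) hreg hDt

theorem exists_eq_smul_add_of_pow_smul_eq (hreg : IsSMulRegular Ω[A⁄R] t)
    (hdvd : ∀ (a : A) (ω : Ω[A⁄R]), a • D R A t = t • ω → t ∣ a)
    (hsep : ∀ (g a : A) (ω : Ω[A⁄R]), D R A g = t • ω + a • D R A t →
      ∃ p : R[X], p.Separable ∧ t ∣ aeval g p)
    {r : ℕ} {ω : Ω[A⁄R]} {g a : A} (h : t ^ r • ω = D R A g + a • D R A t) :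
    ∃ (η : Ω[A⁄R]) (g' a' : A), ω = t • η + (D R A g' + a' • D R A t) := by
  induction r generalizing ω g a with
  | zero => exact ⟨0, g, a, by simpa using h⟩
  | succ r ih =>
    obtain ⟨p, hp, hg⟩ := hsep g (-a) (t ^ r • ω) (by
      rw [smul_smul, ← pow_succ', h, neg_smul, add_neg_cancel_right])
    obtain ⟨η, g₁, a₁, h₁⟩ := exists_pow_smul_sub_eq_of_pow_succ_smul_eq hreg hdvd hp hg h
    obtain ⟨η', g', a', h'⟩ := ih h₁
    exact ⟨η + η', g', a', by rw [smul_add, add_assoc, ← h', add_sub_cancel]⟩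

end Division

/-! ### Fibres with finitely many singular points -/

section Fibre

variable {A : Type*} [CommRing A] [Algebra ℂ A] {f : A} {y : ℂ}

theorem D_sub_algebraMap (f : A) (y : ℂ) : D ℂ A (f - algebraMap ℂ A y) = D ℂ A f := by
  rw [map_sub, Derivation.map_algebraMap, sub_zero]

theorem isSmoothAt_and_D_notMem {m : MaximalSpectrum A} (hm : m ∉ fibre f y ∩ singularSet f)
    (ht : f - algebraMap ℂ A y ∈ m.asIdeal) :
    Algebra.IsSmoothAt ℂ m.asIdeal ∧
      D ℂ A (f - algebraMap ℂ A y) ∉ m.asIdeal • (⊤ : Submodule A Ω[A⁄ℂ]) := by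
  have hm' : m ∉ singularSet f := fun h ↦ hm ⟨ht, h⟩
  rw [singularSet, Set.mem_ofPred_eq, not_or, not_not] at hm'
  rwa [D_sub_algebraMap]

variable [IsDomain A] [Algebra.FiniteType ℂ A]

theorem sub_algebraMap_ne_zero (hdim : ringKrullDim A ≠ 0)
    (hfin : (fibre f y ∩ singularSet f).Finite) : f - algebraMap ℂ A y ≠ 0 := by
  intro h0
  have hDf : D ℂ A f = 0 := by rw [← D_sub_algebraMap f y, h0, map_zero]
  have hall (m : MaximalSpectrum A) : m ∈ fibre f y ∩ singularSet f :=
    ⟨show f - algebraMap ℂ A y ∈ m.asIdeal from h0 ▸ zero_mem _,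
      Or.inr (hDf ▸ zero_mem _)⟩
  have : IsJacobsonRing A := isJacobsonRing_of_finiteType (A := ℂ)
  have hbot : (⊥ : Ideal A).IsMaximal :=
    isMaximal_of_finite_of_forall_mem hfin ⊥ fun m _ ↦ hall m
  exact hdim (ringKrullDim_eq_zero_of_isField (Ring.isField_iff_maximal_bot.2 hbot))

theorem isRadical_span_sub_algebraMap (hdim : 2 ≤ ringKrullDim A)
    (hlci : IsLocallyCompleteIntersection A) (hfin : (fibre f y ∩ singularSet f).Finite) :
    (Ideal.span {f - algebraMap ℂ A y}).IsRadical := by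
  have h0 := sub_algebraMap_ne_zero (two_pos.trans_le hdim).ne' hfin
  intro z hz
  refine hlci.mem_span_singleton_of_forall_notMem_exists_mul_mem hdim h0 hfin fun m hm ↦ ?_
  by_cases ht : f - algebraMap ℂ A y ∈ m.asIdeal
  · obtain ⟨_, hDt⟩ := isSmoothAt_and_D_notMem hm ht
    exact exists_mul_mem_span_of_mem_radical m.asIdeal ht hDt hz
  · exact ⟨_, ht, Ideal.mul_mem_right _ _ (Ideal.mem_span_singleton_self _)⟩

theorem isSMulRegular_kaehlerDifferential_sub_algebraMap (hdim : 2 ≤ ringKrullDim A)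
    (hlci : IsLocallyCompleteIntersection A) (hfin : (fibre f y ∩ singularSet f).Finite) :
    IsSMulRegular Ω[A⁄ℂ] (f - algebraMap ℂ A y) := by
  have h0 := sub_algebraMap_ne_zero (two_pos.trans_le hdim).ne' hfin
  refine isSMulRegular_iff_right_eq_zero_of_smul.2 fun ω hω ↦ ?_
  refine hlci.kaehler_eq_zero_of_forall_notMem_exists_smul_eq_zero hdim hfin fun m hm ↦ ?_
  by_cases ht : f - algebraMap ℂ A y ∈ m.asIdeal
  · obtain ⟨_, -⟩ := isSmoothAt_and_D_notMem hm ht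
    exact exists_smul_eq_zero_of_isSmoothAt m.asIdeal h0 hω
  · exact ⟨_, ht, hω⟩

theorem sub_algebraMap_dvd_of_smul_D_eq (hdim : 2 ≤ ringKrullDim A)
    (hlci : IsLocallyCompleteIntersection A) (hfin : (fibre f y ∩ singularSet f).Finite) {a : A}
    {ω : Ω[A⁄ℂ]} (h : a • D ℂ A (f - algebraMap ℂ A y) = (f - algebraMap ℂ A y) • ω) :
    f - algebraMap ℂ A y ∣ a := by
  have h0 := sub_algebraMap_ne_zero (two_pos.trans_le hdim).ne' hfin
  rw [← Ideal.mem_span_singleton]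
  refine hlci.mem_span_singleton_of_forall_notMem_exists_mul_mem hdim h0 hfin fun m hm ↦ ?_
  by_cases ht : f - algebraMap ℂ A y ∈ m.asIdeal
  · obtain ⟨_, hDt⟩ := isSmoothAt_and_D_notMem hm ht
    exact exists_mul_mem_span_of_smul_D_eq m.asIdeal hDt h
  · exact ⟨_, ht, Ideal.mul_mem_right _ _ (Ideal.mem_span_singleton_self _)⟩

theorem exists_eq_sub_algebraMap_smul_add (hdim : 2 ≤ ringKrullDim A)
    (hlci : IsLocallyCompleteIntersection A) (hfin : (fibre f y ∩ singularSet f).Finite) {r : ℕ}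
    {ω : Ω[A⁄ℂ]} {g a : A} (h : (f - algebraMap ℂ A y) ^ r • ω = D ℂ A g + a • D ℂ A f) :
    ∃ (η : Ω[A⁄ℂ]) (g' a' : A), ω = (f - algebraMap ℂ A y) • η + (D ℂ A g' + a' • D ℂ A f) := by
  rw [← D_sub_algebraMap f y] at h ⊢
  exact exists_eq_smul_add_of_pow_smul_eq
    (isSMulRegular_kaehlerDifferential_sub_algebraMap hdim hlci hfin)
    (fun _ _ ↦ sub_algebraMap_dvd_of_smul_D_eq hdim hlci hfin)
    (fun _ _ _ ↦ exists_separable_dvd_aeval_of_D_eq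
      (isRadical_span_sub_algebraMap hdim hlci hfin)) h

end Fibre

end RelCohomology

theorem mainTheorem6_general (A : Type*) [CommRing A] [IsDomain A] [Algebra ℂ A]
    [Algebra.FiniteType ℂ A] (hdim : 2 ≤ ringKrullDim A)
    (hlci : RelCohomology.IsLocallyCompleteIntersection A) (f : A) (y : ℂ)
    (hfin : (RelCohomology.fibre f y ∩ RelCohomology.singularSet f).Finite) :
    RelCohomology.PropertyP f (RelCohomology.H1 f) y := by
  intro r ω hω
  obtain ⟨ω, rfl⟩ := Submodule.Quotient.mk_surjective _ ω
  rw [← Submodule.Quotient.mk_smul, Submodule.Quotient.mk_eq_zero] at hω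
  obtain ⟨g, a, hga⟩ := hω
  obtain ⟨η, g', a', rfl⟩ := RelCohomology.exists_eq_sub_algebraMap_smul_add hdim hlci hfin hga
  refine ⟨Submodule.Quotient.mk η, ?_⟩
  rw [← Submodule.Quotient.mk_smul, Submodule.Quotient.eq]
  exact ⟨g', a', add_sub_cancel_left _ _⟩

theorem mainTheorem6 (A : Type*) [CommRing A] [IsDomain A] [Algebra ℂ A] [Algebra.FiniteType ℂ A]
    (hdim : ringKrullDim A = 2)
    (hlci : RelCohomology.IsLocallyCompleteIntersection A)
    (f : A) (hf : RelCohomology.IsDominantFunction f) (y : ℂ)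
    (hfin : (RelCohomology.fibre f y ∩ RelCohomology.singularSet f).Finite) :
    RelCohomology.PropertyP f (RelCohomology.H1 f) y :=
  mainTheorem6_general A hdim.ge hlci f y hfin
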